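/- Let $\mathcal N$ be the $\sigma$-ideal of Lebesgue null subsets of $\mathbb R$ and $\mathcal M$ the $\sigma$-ideal of meager subsets of $\mathbb R$. Let $\mathrm{add}(\mathcal N)=\min\{|\mathcal A| : \mathcal A\subseteq\mathcal N,\ \bigcup\mathcal A\notin\mathcal N\}$ and $\mathrm{non}(\mathcal M)=\min\{|X| : X\subseteq\mathbb R,\ X\notin\mathcal M\}$. For $S\subseteq\omega\times\omega$ and $n\in\omega$ put $S(n)=\{m : (n,m)\in S\}$, and write $A\subseteq^* B$ if $A\setminus B$ is finite. Let $$\mathcal S=\{S\subseteq\omega\times\omega : |S(n)|<2^n \text{ for every } n\in\omega\}$$ (the family of slaloms) and $$\mathcal W=\Big\{S\in\mathcal S : S(n)\subseteq\{0,\dots,2^n-1\}\text{ for every } n\in\omega,\ \text{ and } \sum_{n\in\omega}\frac{|S(n)|}{2^n}<\infty\Big\}.$$ **Theorem.** Assume $\mathrm{add}(\mathcal N)=\mathrm{non}(\mathcal M)$. Then there is a $\subseteq^*$-chain $\{A_\alpha : \alpha<\mathrm{add}(\mathcal N)\}\subseteq\mathcal W$, that is, $A_\alpha\subseteq^* A_\beta$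 whenever $\alpha\le\beta<\mathrm{add}(\mathcal N)$, such that for every $S\in\mathcal S$ there is $\alpha<\mathrm{add}(\mathcal N)$ with $A_\alpha\nsubseteq^* S$. -/

import Mathlib

open MeasureTheory

namespace Slalom

/-! ### Cardinal invariants of an ideal of subsets of `K` -/

/-- `add(I)`: the least cardinality of a subfamily of `I` whose union is not in `I`. -/
noncomputable def addIdeal {K : Type*} (I : Set (Set K)) : Cardinal :=
  sInf {c | ∃ A : Set (Set K), A ⊆ I ∧ ⋃₀ A ∉ I ∧ Cardinal.mk A = c}

/-- `non(I)`: the least cardinality of a subset of `K` that is not in `I`. -/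
noncomputable def nonIdeal {K : Type*} (I : Set (Set K)) : Cardinal :=
  sInf {c | ∃ X : Set K, X ∉ I ∧ Cardinal.mk X = c}

/-- The ideal of Lebesgue null sets of reals. -/
def nullIdeal : Set (Set ℝ) := {X | volume X = 0}

/-- The ideal of meager sets of reals. -/
def meagerIdeal : Set (Set ℝ) := {X | IsMeagre X}

/-! ### Slaloms -/

/-- The section `S(n) = {m | (n, m) ∈ S}`. -/
def sect (S : Set (ℕ × ℕ)) (n : ℕ) : Set ℕ := {m | (n, m) ∈ S}

/-- The family of `g`-slaloms: `|S(n)| < g(n)` for every `n`. -/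
def slaloms (g : ℕ → ℕ) : Set (Set (ℕ × ℕ)) := {S | ∀ n, (sect S n).encard < (g n : ℕ∞)}

/-- The family of slaloms, that is, of `h`-slaloms for `h(n) = 2 ^ n`. -/
def familyS : Set (Set (ℕ × ℕ)) := slaloms (fun n => 2 ^ n)

/-- The sets with `S(n) ⊆ {0, …, 2 ^ n - 1}` for every `n` and `∑ |S(n)| / 2 ^ n < ∞`. -/
def familyI : Set (Set (ℕ × ℕ)) :=
  {S | (∀ n, sect S n ⊆ Set.Iio (2 ^ n)) ∧
    Summable (fun n : ℕ => ((sect S n).ncard : ℝ) / 2 ^ n)}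

/-- The slaloms in `familyI`. -/
def familyW : Set (Set (ℕ × ℕ)) := familyI ∩ familyS

/-- `A ⊆* B`: the difference `A \ B` is finite. -/
def AlmostSubset {X : Type*} (A B : Set X) : Prop := (A \ B).Finite

end Slalom

namespace Slalom

open ProbabilityTheory Filter Topology Cardinal
open scoped ENNReal unitInterval

/-! ### Independent sets and the summable ideal -/

/-! Code reals by the graphs of their blocks of binary digits. A single slalom almost contains the
graphs of only meagerly many reals (`isMeagre_digitGraph_almostSubset`), so no slalom almost
contains all graphs from a nonmeager set. When `add(N) = non(M)`, a nonmeager set can be listed in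
length `add(N)`, and a recursion of that length builds a chain absorbing its graphs one by one. The
recursion survives limits because fewer than `add(N)` sets of finite weight have a pseudo-union of
finite weight (`exists_almost_bound_of_summable`): summability is coded into null sets through
independent events, and Baire category on a closed set avoiding those null sets decodes a countable
family of bounds. -/

/-- The unit interval carries independent sets of any prescribed countable list of measures. -/
lemma exists_iIndepSet_unitInterval {ι : Type*} [Countable ι] (w : ι → I) :
    ∃ E : ι → Set I, (∀ i, MeasurableSet (E i)) ∧ iIndepSet E volume ∧
      ∀ i, volume (E i) = ENNReal.ofReal (w i) := by
  -- A product of copies of Lebesgue measure is an image of Lebesgue measure on `I`; events on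
  -- distinct coordinates pull back to independent sets.
  obtain ⟨f, hf, hmap⟩ :=
    (Measure.infinitePi fun _ : ι ↦ (volume : Measure I)).exists_measurable_map_eq
  have hm (i : ι) : MeasurableSet ((fun y : ι → I ↦ y i) ⁻¹' Set.Iic (w i)) :=
    measurable_pi_apply i measurableSet_Iic
  have key (s : Finset ι) : volume (⋂ i ∈ s, f ⁻¹' ((fun y : ι → I ↦ y i) ⁻¹' Set.Iic (w i)))
      = ∏ i ∈ s, ENNReal.ofReal (w i) := by
    have : ⋂ i ∈ s, f ⁻¹' ((fun y : ι → I ↦ y i) ⁻¹' Set.Iic (w i))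
        = f ⁻¹' (Set.pi s fun i ↦ Set.Iic (w i)) := by
      ext; simp [Set.mem_pi]
    rw [this, ← Measure.map_apply hf (MeasurableSet.pi s.countable_toSet
      fun _ _ ↦ measurableSet_Iic), hmap, Measure.infinitePi_pi _ fun _ _ ↦ measurableSet_Iic]
    simp [unitInterval.volume_Iic]
  have hE (i : ι) : volume (f ⁻¹' ((fun y : ι → I ↦ y i) ⁻¹' Set.Iic (w i)))
      = ENNReal.ofReal (w i) := by simpa using key {i}
  refine ⟨fun i ↦ f ⁻¹' ((fun y : ι → I ↦ y i) ⁻¹' Set.Iic (w i)), fun i ↦ hf (hm i), ?_, hE⟩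
  rw [iIndepSet_iff_meas_biInter fun i ↦ hf (hm i)]
  intro s
  rw [key]
  exact Finset.prod_congr rfl fun i _ ↦ (hE i).symm

/-- A set of positive measure misses only summably many of a family of independent sets. -/
lemma tsum_ne_top_of_iIndepSet {Ω ι : Type*} [Countable ι] [MeasurableSpace Ω] {μ : Measure Ω}
    {E : ι → Set Ω} (hm : ∀ i, MeasurableSet (E i)) (hE : iIndepSet E μ) {B : Set ι} {C : Set Ω}
    (hC : μ C ≠ 0) (hd : ∀ i ∈ B, Disjoint C (E i)) : ∑' i : B, μ (E i) ≠ ∞ := by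
  have := hE.isProbabilityMeasure
  intro htop
  rcases B.finite_or_infinite with hB | hB
  · have := hB.fintype
    rw [tsum_fintype] at htop
    exact (ENNReal.sum_lt_top.2 fun i _ ↦ measure_lt_top μ _).ne htop
  have := hB.to_subtype
  obtain ⟨_⟩ := nonempty_denumerable B
  let e : ℕ ≃ B := (Denumerable.eqv B).symm
  -- Second Borel–Cantelli: almost every point lies in infinitely many of these sets, but no point
  -- of `C` lies in any.
  have h1 := measure_limsup_eq_one (s := fun n ↦ E (e n)) (fun n ↦ hm _)
    (hE.precomp (g := fun n ↦ (e n : ι)) (Subtype.val_injective.comp e.injective))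
    (by rw [← htop]; exact e.tsum_eq fun i : B ↦ μ (E i))
  have hms : MeasurableSet (limsup (fun n ↦ E (e n)) atTop) :=
    MeasurableSet.measurableSet_limsup fun n ↦ hm _
  refine hC (measure_mono_null (t := (limsup (fun n ↦ E (e n)) atTop)ᶜ) (fun x hx hx' ↦ ?_)
    ((prob_compl_eq_zero_iff hms).2 h1))
  obtain ⟨n, hn⟩ := (mem_limsup_iff_frequently_mem.1 hx').exists
  exact Set.disjoint_left.1 (hd _ (e n).2) hx hn

/-- The ideal of sets of finite total weight is a P-ideal. -/
lemma exists_almost_union {ι : Type*} {w : ι → ℝ≥0∞} {B : ℕ → Set ι}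
    (h : ∀ j, ∑' i : B j, w i ≠ ∞) :
    ∃ C : Set ι, ∑' i : C, w i ≠ ∞ ∧ ∀ j, AlmostSubset (B j) C := by
  obtain ⟨ε, hε, hsum⟩ := ENNReal.exists_pos_sum_of_countable' one_ne_zero ℕ
  have hF (j : ℕ) : ∃ F : Finset (B j), ∑' i : {x // x ∉ F}, w i.1 < ε j :=
    ((ENNReal.tendsto_tsum_compl_atTop_zero (h j)).eventually_lt_const (hε j)).exists
  choose F hF using hF
  refine ⟨⋃ j, Subtype.val '' {x : B j | x ∉ F j}, ?_, fun j ↦ ?_⟩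
  · refine ((ENNReal.tsum_iUnion_le_tsum w _).trans ?_).trans_lt
      (hsum.trans ENNReal.one_lt_top) |>.ne
    refine ENNReal.tsum_le_tsum fun j ↦ ?_
    rw [tsum_image w Subtype.val_injective.injOn]
    exact (hF j).le
  · refine ((F j).finite_toSet.image Subtype.val).subset fun x hx ↦ ?_
    refine ⟨⟨x, hx.1⟩, ?_, rfl⟩
    by_contra hxF
    exact hx.2 (Set.mem_iUnion.2 ⟨j, ⟨x, hx.1⟩, hxF, rfl⟩)

/-! ### Additivity of the null ideal -/

lemma volume_iUnion_eq_zero {κ : Type} (hκ : #κ < addIdeal nullIdeal) {N : κ → Set ℝ}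
    (hN : ∀ a, volume (N a) = 0) : volume (⋃ a, N a) = 0 := by
  by_contra h
  refine notMem_of_lt_csInf' (mk_range_le.trans_lt hκ) ⟨Set.range N, ?_, ?_, rfl⟩
  · rintro _ ⟨a, rfl⟩
    exact hN a
  · rwa [Set.sUnion_range]

lemma unitInterval_volume_iUnion_eq_zero {κ : Type} (hκ : #κ < addIdeal nullIdeal) {N : κ → Set I}
    (hN : ∀ a, volume (N a) = 0) : volume (⋃ a, N a) = 0 := by
  have hval (s : Set I) : volume s = volume (Subtype.val '' s : Set ℝ) :=
    (MeasurableEmbedding.subtype_coe measurableSet_Icc).comap_apply _ _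
  rw [hval, Set.image_iUnion]
  exact volume_iUnion_eq_zero hκ fun a ↦ (hval _).symm.trans (hN a)

/-- Outside a null set there is a closed set all of whose nonempty relatively open subsets have
positive measure. -/
lemma exists_isClosed_pos_of_null {N : Set I} (hN : volume N = 0) :
    ∃ K : Set I, IsClosed K ∧ K.Nonempty ∧ Disjoint K N ∧
      ∀ U, IsOpen U → (K ∩ U).Nonempty → volume (K ∩ U) ≠ 0 := by
  have hpos : (0 : ℝ≥0∞) < volume (toMeasurable volume N)ᶜ := by
    rw [prob_compl_eq_one_sub (measurableSet_toMeasurable _ _), measure_toMeasurable, hN]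
    simp
  obtain ⟨C, hCN, hC, hC0⟩ :=
    (measurableSet_toMeasurable volume N).compl.exists_lt_isClosed_of_ne_top
      (measure_ne_top _ _) hpos
  set μ := volume.restrict C with hμ
  have hnull : μ μ.supportᶜ = 0 := Measure.measure_compl_support
  have hμ0 : μ ≠ 0 := by simpa [hμ] using hC0.ne'
  have hsub : μ.support ⊆ C := Measure.support_restrict_subset.trans (by simp)
  refine ⟨μ.support, Measure.isClosed_support, Measure.nonempty_support hμ0, ?_, ?_⟩
  · rw [Set.disjoint_left]
    exact fun x hx hxN ↦ hCN (hsub hx) (subset_toMeasurable _ _ hxN)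
  · rintro U hU ⟨x, hx, hxU⟩ h0
    have h1 := (Measure.mem_support_iff_forall x).1 hx U (hU.mem_nhds hxU)
    have h2 : μ U ≤ μ (μ.support ∩ U) + μ μ.supportᶜ := by
      refine (measure_mono fun y hy ↦ ?_).trans (measure_union_le _ _)
      by_cases hys : y ∈ μ.support
      exacts [Or.inl ⟨hys, hy⟩, Or.inr hys]
    have h3 : μ (μ.support ∩ U) = 0 :=
      le_antisymm ((Measure.restrict_apply_le _ _).trans h0.le) bot_le
    rw [hnull, h3] at h2
    exact absurd h1 (by simpa using h2)

/-- Fewer than `add(N)` sets of finite total weight are almost contained in a single one. -/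
lemma exists_almost_bound_of_summable {ι κ : Type} [Countable ι] (hκ : #κ < addIdeal nullIdeal)
    (w : ι → I) {A : κ → Set ι} (hA : ∀ a, ∑' i : A a, ENNReal.ofReal (w i) ≠ ∞) :
    ∃ C : Set ι, ∑' i : C, ENNReal.ofReal (w i) ≠ ∞ ∧ ∀ a, AlmostSubset (A a) C := by
  obtain ⟨E, hm, hind, hE⟩ := exists_iIndepSet_unitInterval w
  obtain ⟨ε, hε, hsum⟩ := ENNReal.exists_pos_sum_of_countable' one_ne_zero ι
  have hG (i : ι) := (E i).exists_isOpen_lt_add (measure_ne_top volume _) (hε i).ne'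
  choose G hEG hGo hGm using hG
  -- First Borel–Cantelli. The enlargement of `E i` to the open `G i` costs only a summable error
  -- and makes the sets in the Baire argument closed.
  have hnull (a : κ) : volume {x | {i : A a | x ∈ G i}.Infinite} = 0 := by
    refine ae_iff.1 (ae_finite_setOfPred_mem (s := fun i : A a ↦ G i) (ne_top_of_le_ne_top ?_
      (ENNReal.tsum_le_tsum fun i : A a ↦ (hGm i).le)))
    rw [ENNReal.tsum_add]
    refine ENNReal.add_ne_top.2 ⟨by simpa only [hE] using hA a, ?_⟩
    exact ne_top_of_le_ne_top (hsum.trans ENNReal.one_lt_top).ne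
      (ENNReal.tsum_comp_le_tsum_of_injective Subtype.val_injective ε)
  obtain ⟨K, hK, hKne, hKd, hKpos⟩ :=
    exists_isClosed_pos_of_null (unitInterval_volume_iUnion_eq_zero hκ hnull)
  have hb := TopologicalSpace.isBasis_countableBasis I
  -- These countably many sets are the candidate bounds: each `A a` will be almost contained in one
  -- of them.
  let B (U : TopologicalSpace.countableBasis I) : Set ι :=
    {i | (K ∩ U).Nonempty ∧ Disjoint (K ∩ U) (E i)}
  have hB (U : TopologicalSpace.countableBasis I) : ∑' i : B U, ENNReal.ofReal (w i) ≠ ∞ := by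
    by_cases hU : (K ∩ U).Nonempty
    · simp_rw [← hE]
      exact tsum_ne_top_of_iIndepSet hm hind (hKpos U (hb.isOpen U.2) hU) fun i hi ↦ hi.2
    · simp [B, hU]
  have hBase : Nonempty (TopologicalSpace.countableBasis I) := by
    obtain ⟨U, hU, -⟩ := hb.exists_subset_of_mem_open (Set.mem_univ (0 : I)) isOpen_univ
    exact ⟨⟨U, hU⟩⟩
  obtain ⟨u, hu⟩ := exists_surjective_nat (TopologicalSpace.countableBasis I)
  obtain ⟨C, hC, hBC⟩ := exists_almost_union
    (w := fun i ↦ ENNReal.ofReal (w i)) (B := fun j ↦ B (u j)) fun j ↦ hB (u j)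
  refine ⟨C, hC, fun a ↦ ?_⟩
  have := hKne.to_subtype
  have : CompactSpace K := isCompact_iff_compactSpace.1 hK.isCompact
  -- Each point of `K` lies in finitely many `G i` with `i ∈ A a`, so by Baire one finite
  -- exceptional set `F` serves a whole relatively open piece of `K`.
  obtain ⟨F, x, hx⟩ := nonempty_interior_of_iUnion_of_closed
    (f := fun F : Finset (A a) ↦ {x : K | ∀ i : A a, i ∉ F → x.1 ∉ G i})
    (fun F ↦ by
      simp only [Set.ofPred_forall]
      exact isClosed_iInter fun i ↦ isClosed_iInter fun _ ↦
        (hGo i).isClosed_compl.preimage continuous_subtype_val)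
    (Set.eq_univ_of_forall fun x ↦ by
      have hfin : {i : A a | x.1 ∈ G i}.Finite := by
        by_contra hinf
        exact Set.disjoint_left.1 hKd x.2 (Set.mem_iUnion.2 ⟨a, hinf⟩)
      refine Set.mem_iUnion.2 ⟨hfin.toFinset, fun i hi hxi ↦ hi ?_⟩
      simpa using hxi)
  obtain ⟨V, hV, hVx⟩ := isOpen_induced_iff.1 (isOpen_interior (s :=
    {x : K | ∀ i : A a, i ∉ F → x.1 ∉ G i}))
  have hxV : x.1 ∈ V := by rw [← hVx] at hx; exact hx
  obtain ⟨U, hU, hxU, hUV⟩ := hb.exists_subset_of_mem_open hxV hV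
  obtain ⟨j, hj⟩ := hu ⟨U, hU⟩
  refine ((F.finite_toSet.image Subtype.val).union (hBC j)).subset fun i hi ↦ ?_
  by_cases hiF : (⟨i, hi.1⟩ : A a) ∈ F
  · exact Or.inl ⟨_, hiF, rfl⟩
  refine Or.inr ⟨?_, hi.2⟩
  rw [hj]
  refine ⟨⟨x, x.2, hxU⟩, Set.disjoint_left.2 fun y hy hyE ↦ ?_⟩
  have hyi : (⟨y, hy.1⟩ : K) ∈ interior {x : K | ∀ i : A a, i ∉ F → x.1 ∉ G i} := by
    rw [← hVx]; exact hUV hy.2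
  exact interior_subset hyi ⟨i, hi.1⟩ hiF (hEG i hyE)

/-! ### The family `familyI` -/

lemma AlmostSubset.trans {X : Type*} {A B C : Set X} (h₁ : AlmostSubset A B)
    (h₂ : AlmostSubset B C) : AlmostSubset A C :=
  (h₁.union h₂).subset fun x hx ↦ by
    by_cases hB : x ∈ B
    exacts [Or.inr ⟨hB, hx.2⟩, Or.inl ⟨hx.1, hB⟩]

lemma almostSubset_of_subset {X : Type*} {A B : Set X} (h : A ⊆ B) : AlmostSubset A B := by
  simp [AlmostSubset, Set.sdiff_eq_empty.2 h]

/-- The weight of the points in column `n`. -/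
noncomputable def columnWeight (p : ℕ × ℕ) : I :=
  ⟨2⁻¹ ^ p.1, by positivity, pow_le_one₀ (by positivity) (by norm_num)⟩

lemma tsum_columnWeight (S : Set (ℕ × ℕ)) (h : ∀ n, (sect S n).Finite) :
    ∑' p : S, ENNReal.ofReal (columnWeight p)
      = ∑' n, ENNReal.ofReal ((sect S n).ncard / 2 ^ n) := by
  rw [tsum_subtype S fun p ↦ ENNReal.ofReal (columnWeight p), ENNReal.tsum_prod']
  refine tsum_congr fun n ↦ ?_
  have : ∀ m, S.indicator (fun p ↦ ENNReal.ofReal (columnWeight p)) (n, m)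
      = (sect S n).indicator (fun _ ↦ ENNReal.ofReal (2⁻¹ ^ n)) m := fun m ↦ by
    by_cases hm : (n, m) ∈ S <;> simp [Set.indicator, sect, hm, columnWeight]
  simp_rw [this]
  rw [← tsum_subtype, ENNReal.tsum_set_const, ← (h n).cast_ncard_eq, div_eq_mul_inv,
    ENNReal.ofReal_mul (by positivity)]
  simp

lemma mem_familyI_iff {S : Set (ℕ × ℕ)} : S ∈ familyI ↔
    (∀ n, sect S n ⊆ Set.Iio (2 ^ n)) ∧ ∑' p : S, ENNReal.ofReal (columnWeight p) ≠ ∞ := by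
  refine and_congr_right fun h ↦ ?_
  rw [tsum_columnWeight S fun n ↦ (Set.finite_Iio _).subset (h n)]
  refine ⟨fun hs ↦ hs.tsum_ofReal_ne_top, fun hs ↦ ?_⟩
  have := ENNReal.summable_toReal hs
  refine this.congr fun n ↦ ?_
  rw [ENNReal.toReal_ofReal (by positivity)]

lemma familyI_union {S T : Set (ℕ × ℕ)} (hS : S ∈ familyI) (hT : T ∈ familyI) :
    S ∪ T ∈ familyI := by
  rw [mem_familyI_iff] at *
  refine ⟨fun n ↦ Set.union_subset (hS.1 n) (hT.1 n), ?_⟩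
  exact ne_top_of_le_ne_top (ENNReal.add_ne_top.2 ⟨hS.2, hT.2⟩)
    (ENNReal.tsum_union_le (fun p ↦ ENNReal.ofReal (columnWeight p)) S T)

/-- Removing finitely many columns turns a member of `familyI` into a slalom. -/
lemma exists_familyW_almostSubset {S : Set (ℕ × ℕ)} (hS : S ∈ familyI) :
    ∃ T ∈ familyW, AlmostSubset S T := by
  have hfin (n : ℕ) : (sect S n).Finite := (Set.finite_Iio _).subset (hS.1 n)
  obtain ⟨N, hN⟩ := eventually_atTop.1
    (hS.2.tendsto_atTop_zero.eventually_lt_const (zero_lt_one' ℝ))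
  have hsub : {p ∈ S | N ≤ p.1} ⊆ S := fun p hp ↦ hp.1
  refine ⟨{p ∈ S | N ≤ p.1}, ⟨?_, fun n ↦ ?_⟩, ?_⟩
  · rw [mem_familyI_iff] at hS ⊢
    exact ⟨fun n m hm ↦ hS.1 n hm.1, ne_top_of_le_ne_top hS.2
      (ENNReal.tsum_mono_subtype (fun p ↦ ENNReal.ofReal (columnWeight p)) hsub)⟩
  · by_cases hn : N ≤ n
    · have h1 := hN n hn
      rw [div_lt_one (by positivity)] at h1
      have h2 : (sect S n).ncard < 2 ^ n := by exact_mod_cast h1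
      refine (Set.encard_le_encard (t := sect S n) fun m hm ↦ hm.1).trans_lt ?_
      rw [← (hfin n).cast_ncard_eq]
      exact_mod_cast h2
    · have : sect {p ∈ S | N ≤ p.1} n = ∅ := by
        ext m; simp [sect, hn]
      rw [this, Set.encard_empty]
      positivity
  · refine ((Set.finite_Iio N).biUnion fun n _ ↦ (hfin n).image (Prod.mk n)).subset ?_
    rintro ⟨n, m⟩ ⟨hp, hp'⟩
    have : n < N := by
      by_contra hn
      exact hp' ⟨hp, not_lt.1 hn⟩
    exact Set.mem_biUnion (Set.mem_Iio.2 this) ⟨m, hp, rfl⟩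

/-- Fewer than `add(N)` members of `familyI` have an almost-upper bound in `familyI`. -/
lemma exists_familyI_almost_bound {𝒜 : Set (Set (ℕ × ℕ))} (hcard : #𝒜 < addIdeal nullIdeal)
    (h𝒜 : 𝒜 ⊆ familyI) : ∃ C ∈ familyI, ∀ A ∈ 𝒜, AlmostSubset A C := by
  obtain ⟨C, hC, hAC⟩ := exists_almost_bound_of_summable hcard columnWeight
    (A := fun a : 𝒜 ↦ a.1) fun a ↦ (mem_familyI_iff.1 (h𝒜 a.2)).2
  refine ⟨{p ∈ C | p.2 < 2 ^ p.1}, mem_familyI_iff.2 ⟨fun n m hm ↦ hm.2, ?_⟩, fun A hA ↦ ?_⟩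
  · exact ne_top_of_le_ne_top hC
      (ENNReal.tsum_mono_subtype (fun p ↦ ENNReal.ofReal (columnWeight p)) fun p hp ↦ hp.1)
  · refine (hAC ⟨A, hA⟩).subset fun p hp ↦ ⟨hp.1, fun hpC ↦ hp.2 ⟨hpC, ?_⟩⟩
    exact (h𝒜 hA).1 p.1 hp.1

/-! ### Digits of reals and meager sets -/

/-- The `n`-th block of binary digits of `x`, a number below `2 ^ n`. -/
noncomputable def digitBlock (x : ℝ) (n : ℕ) : ℕ := (⌊x * 4 ^ n⌋ % 2 ^ n).toNat

/-- The graph of the sequence of digit blocks of `x`. -/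
def digitGraph (x : ℝ) : Set (ℕ × ℕ) := {p | p.2 = digitBlock x p.1}

lemma sect_digitGraph (x : ℝ) (n : ℕ) : sect (digitGraph x) n = {digitBlock x n} := rfl

lemma digitGraph_mem_familyI (x : ℝ) : digitGraph x ∈ familyI := by
  refine ⟨fun n ↦ ?_, ?_⟩
  · have h1 := Int.emod_lt_of_pos ⌊x * 4 ^ n⌋ (b := 2 ^ n) (by positivity)
    have h2 := Int.emod_nonneg ⌊x * 4 ^ n⌋ (b := 2 ^ n) (by positivity)
    rw [sect_digitGraph, Set.singleton_subset_iff, Set.mem_Iio, digitBlock]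
    zify
    rwa [Int.toNat_of_nonneg h2]
  · simp_rw [sect_digitGraph, Set.ncard_singleton]
    simpa using summable_geometric_two

/-- In every interval all values of all late digit blocks occur on a subinterval. -/
lemma exists_Ioo_digitBlock_eq {a b : ℝ} (hab : a < b) (N : ℕ) :
    ∃ n ≥ N, ∀ v < 2 ^ n, ∃ c d, c < d ∧ Set.Ioo c d ⊆ Set.Ioo a b ∧
      ∀ x ∈ Set.Ioo c d, digitBlock x n = v := by
  obtain ⟨n, hnN, hn⟩ : ∃ n ≥ N, 2 < (b - a) * 2 ^ n := by
    have := (tendsto_pow_atTop_atTop_of_one_lt (one_lt_two (α := ℝ))).const_mul_atTop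
      (sub_pos.2 hab)
    exact ((eventually_ge_atTop N).and (this.eventually_gt_atTop 2)).exists
  refine ⟨n, hnN, fun v hv ↦ ?_⟩
  have h4 : (4 : ℝ) ^ n = 2 ^ n * 2 ^ n := by rw [← mul_pow]; norm_num
  -- The dyadic interval from `k / 2 ^ n` to `(k + 1) / 2 ^ n` lies inside `(a, b)`; block `n`
  -- consists of the next `n` binary digits, which are still free there.
  set k : ℤ := ⌊a * 2 ^ n⌋ + 1 with hk
  have hP : (0 : ℝ) < 2 ^ n := by positivity
  have hQ : (0 : ℝ) < 4 ^ n := by positivity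
  have hk1 : a * 2 ^ n < k := by rw [hk]; push_cast; exact Int.lt_floor_add_one _
  have hk2 : (k : ℝ) + 1 < b * 2 ^ n := by
    rw [hk]; push_cast; linarith [Int.floor_le (a * 2 ^ n)]
  have hv1 : (v : ℝ) + 1 ≤ 2 ^ n := by exact_mod_cast hv
  have hv0 : (0 : ℝ) ≤ v := v.cast_nonneg
  refine ⟨(2 ^ n * k + v) / 4 ^ n, (2 ^ n * k + v + 1) / 4 ^ n,
    div_lt_div_of_pos_right (lt_add_one _) hQ,
    Set.Ioo_subset_Ioo ?_ ?_, fun x hx ↦ ?_⟩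
  · rw [le_div_iff₀ hQ, h4]; nlinarith
  · rw [div_le_iff₀ hQ, h4]; nlinarith
  · have hfl : ⌊x * 4 ^ n⌋ = v + 2 ^ n * k := by
      rw [Int.floor_eq_iff]
      have h1 := (div_lt_iff₀ hQ).1 hx.1
      have h2 := (lt_div_iff₀ hQ).1 hx.2
      push_cast
      constructor <;> linarith
    have : ((v : ℤ) % 2 ^ n) = v := Int.emod_eq_of_lt (by positivity) (by exact_mod_cast hv)
    rw [digitBlock, hfl, Int.add_mul_emod_self_left, this, Int.toNat_natCast]

/-- A slalom omits some value below `2 ^ n` in every column, and any interval has a subinterval on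
which a late block takes that value; so capture from a fixed column on is nowhere dense. -/
lemma isMeagre_digitGraph_almostSubset {S : Set (ℕ × ℕ)} (hS : S ∈ familyS) :
    IsMeagre {x | AlmostSubset (digitGraph x) S} := by
  have hsub : {x | AlmostSubset (digitGraph x) S} ⊆
      ⋃ N : ℕ, {x | ∀ n ≥ N, digitBlock x n ∈ sect S n} := by
    intro x hx
    obtain ⟨N, hN⟩ := (hx.image Prod.fst).bddAbove
    refine Set.mem_iUnion.2 ⟨N + 1, fun n hn ↦ ?_⟩
    by_contra hxn
    have : n ≤ N := hN ⟨(n, digitBlock x n), ⟨rfl, hxn⟩, rfl⟩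
    omega
  refine IsMeagre.mono hsub (isMeagre_iUnion fun N ↦ IsNowhereDense.isMeagre ?_)
  rw [IsNowhereDense, Set.eq_empty_iff_forall_notMem]
  intro x hx
  obtain ⟨a, b, hxab, hab⟩ := mem_nhds_iff_exists_Ioo_subset.1 (mem_interior_iff_mem_nhds.1 hx)
  obtain ⟨n, hn, h⟩ := exists_Ioo_digitBlock_eq (hxab.1.trans hxab.2) N
  obtain ⟨v, hv, hvS⟩ : ∃ v < 2 ^ n, v ∉ sect S n := by
    by_contra! hall
    have h1 := (Set.encard_le_encard (s := Set.Iio (2 ^ n)) hall).trans_lt (hS n)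
    simp [Set.encard_eq_coe_toFinset_card] at h1
  obtain ⟨c, d, hcd, hsub, hval⟩ := h v hv
  obtain ⟨y, hy⟩ := Set.nonempty_Ioo.2 hcd
  obtain ⟨z, hz, hzS⟩ := mem_closure_iff.1 (hab (hsub hy)) _ isOpen_Ioo hy
  exact hvS (hval z hz ▸ hzS n hn)

/-- A nonmeager set of reals of size `non(M)`, enumerated by the ordinals below `non(M)`. -/
lemma exists_enum_not_isMeagre : ∃ e : Ordinal.{0} → ℝ,
    ¬ IsMeagre (e '' Set.Iio (nonIdeal meagerIdeal).ord) := by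
  obtain ⟨X, hX, hcard⟩ : nonIdeal meagerIdeal ∈
      {c | ∃ X : Set ℝ, X ∉ meagerIdeal ∧ Cardinal.mk X = c} :=
    csInf_mem ⟨_, Set.univ, not_isMeagre_of_isOpen isOpen_univ Set.univ_nonempty, rfl⟩
  obtain ⟨f⟩ : Nonempty (Set.Iio (nonIdeal meagerIdeal).ord ≃ X) := by
    rw [← Cardinal.lift_mk_eq', Cardinal.mk_Iio_ordinal, card_ord, ← hcard]
    simp
  refine ⟨fun α ↦ if h : α ∈ Set.Iio (nonIdeal meagerIdeal).ord then f ⟨α, h⟩ else 0, fun hm ↦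
    hX (IsMeagre.mono (fun x hx ↦ ?_) hm)⟩
  have hlt := (f.symm ⟨x, hx⟩).2
  refine ⟨f.symm ⟨x, hx⟩, hlt, ?_⟩
  exact (dif_pos hlt).trans (congrArg Subtype.val (f.apply_symm_apply ⟨x, hx⟩))

/-- Transfinite construction of an almost increasing sequence in `familyW` absorbing a given
sequence in `familyI`. -/
lemma exists_familyW_chain (D : Ordinal.{0} → Set (ℕ × ℕ)) (hD : ∀ α, D α ∈ familyI) :
    ∃ A : Ordinal.{0} → Set (ℕ × ℕ), ∀ α < (addIdeal nullIdeal).ord,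
      A α ∈ familyW ∧ AlmostSubset (D α) (A α) ∧ ∀ β < α, AlmostSubset (A β) (A α) := by
  classical
  let P (α : Ordinal.{0}) (F : ∀ β < α, Set (ℕ × ℕ)) (T : Set (ℕ × ℕ)) : Prop :=
    T ∈ familyW ∧ AlmostSubset (D α) T ∧ ∀ β (h : β < α), AlmostSubset (F β h) T
  let step (α : Ordinal.{0}) (F : ∀ β < α, Set (ℕ × ℕ)) : Set (ℕ × ℕ) :=
    -- The default is never used below `add(N)`, where fewer than `add(N)` predecessors have to be
    -- bounded.
    if h : ∃ T, P α F T then h.choose else ∅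
  let A : Ordinal.{0} → Set (ℕ × ℕ) := WellFounded.fix Ordinal.lt_wf step
  have hA (α : Ordinal.{0}) : A α = step α fun β _ ↦ A β := WellFounded.fix_eq _ _ _
  refine ⟨A, fun α ↦ ?_⟩
  induction α using WellFoundedLT.induction with
  | _ α ih =>
  intro hα
  have hex : ∃ T, P α (fun β _ ↦ A β) T := by
    have hcard : #(A '' Set.Iio α) < addIdeal nullIdeal := by
      have h1 := mk_image_le_lift (f := A) (s := Set.Iio α)
      rw [Cardinal.mk_Iio_ordinal, Cardinal.lift_lift, Cardinal.lift_le] at h1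
      exact h1.trans_lt (Cardinal.lt_ord.1 hα)
    obtain ⟨C, hC, hAC⟩ := exists_familyI_almost_bound hcard (by
      rintro _ ⟨β, hβ, rfl⟩
      exact (ih β hβ (lt_trans hβ hα)).1.1)
    obtain ⟨T, hT, hCT⟩ := exists_familyW_almostSubset (familyI_union (hD α) hC)
    exact ⟨T, hT, (almostSubset_of_subset Set.subset_union_left).trans hCT, fun β hβ ↦
      (hAC _ ⟨β, hβ, rfl⟩).trans ((almostSubset_of_subset Set.subset_union_right).trans hCT)⟩
  have hch : A α = hex.choose := by rw [hA]; exact dif_pos hex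
  rw [hch]
  exact hex.choose_spec

end Slalom

theorem mainTheorem9
    (h : Slalom.addIdeal Slalom.nullIdeal = Slalom.nonIdeal Slalom.meagerIdeal) :
    ∃ A : Ordinal.{0} → Set (ℕ × ℕ),
      (∀ α < (Slalom.addIdeal Slalom.nullIdeal).ord, A α ∈ Slalom.familyW) ∧
      (∀ α β : Ordinal.{0}, α ≤ β → β < (Slalom.addIdeal Slalom.nullIdeal).ord →
        Slalom.AlmostSubset (A α) (A β)) ∧
      (∀ S ∈ Slalom.familyS, ∃ α < (Slalom.addIdeal Slalom.nullIdeal).ord,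
        ¬ Slalom.AlmostSubset (A α) S) := by
  obtain ⟨e, he⟩ := Slalom.exists_enum_not_isMeagre
  obtain ⟨A, hA⟩ := Slalom.exists_familyW_chain (fun α ↦ Slalom.digitGraph (e α))
    fun α ↦ Slalom.digitGraph_mem_familyI _
  refine ⟨A, fun α hα ↦ (hA α hα).1, fun α β hαβ hβ ↦ ?_, fun S hS ↦ ?_⟩
  · rcases hαβ.eq_or_lt with rfl | hlt
    exacts [Slalom.almostSubset_of_subset subset_rfl, (hA β hβ).2.2 α hlt]
  · by_contra! hall
    refine he (IsMeagre.mono ?_ (Slalom.isMeagre_digitGraph_almostSubset hS))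
    rintro _ ⟨α, hα, rfl⟩
    have hα' : α < (Slalom.addIdeal Slalom.nullIdeal).ord := by rw [h]; exact hα
    exact (hA α hα').2.1.trans (hall α hα')
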